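/- Let $\gamma\in[0,1]$, $x\in\mathbb{R}$ and $r(z)=r(z;\gamma)=-\mathrm{i}\sqrt{\gamma}\,\mathrm{e}^{-z^2/4}$ for $z\in\mathbb{R}$. Consider the following Riemann–Hilbert problem for the Zakharov–Shabat system: determine $\mathbf{X}:\mathbb{C}\setminus\mathbb{R}\to\mathbb{C}^{2\times 2}$ such that (1) $\mathbf{X}$ is analytic on $\mathbb{C}\setminus\mathbb{R}$, and its restrictions to the open upper and to the open lower half-plane extend continuously to the closed upper and to the closed lower half-plane, respectively; (2) the limiting values $\mathbf{X}_\pm(z)=\lim_{\epsilon\downarrow 0}\mathbf{X}(z\pm\mathrm{i}\epsilon)$, $z\in\mathbb{R}$, satisfy $$\mathbf{X}_+(z)=\mathbf{X}_-(z)\begin{bmatrix}1-|r(z)|^2 & -\overline{r(z)}\,\mathrm{e}^{-2\mathrm{i}xz}\\ r(z)\,\mathrm{e}^{2\mathrm{i}xz} & 1\end{bmatrix},\qquad z\in\mathbb{R};$$ (3) there are matrices $\mathbf{X}_1,\mathbf{X}_2\in\mathbb{C}^{2\times 2}$ such that $\mathbf{X}(z)=\mathbb{I}+\mathbf{X}_1z^{-1}+\mathbf{X}_2z^{-2}+\mathcal{O}(z^{-3})$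 as $z\to\infty$, $z\in\mathbb{C}\setminus\mathbb{R}$. Then for every $(x,\gamma)\in\mathbb{R}\times[0,1]$, including $\gamma=1$, this problem has exactly one solution $\mathbf{X}(z)=\mathbf{X}(z;x,\gamma)$. -/

import Mathlib

open Filter Topology Asymptotics

namespace ZakharovShabat

/-- The reflection coefficient `r(z; γ) = -i √γ exp(-z² / 4)`, for real `z`. -/
noncomputable def reflection (γ : ℝ) (z : ℝ) : ℂ :=
  -Complex.I * (Real.sqrt γ : ℂ) * Complex.exp (-(1 / 4) * (z : ℂ) ^ 2)

/-- The jump matrix of the Zakharov–Shabat problem with reflection coefficient `r`, at real `z`. -/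
noncomputable def jumpMatrix (r : ℝ → ℂ) (x z : ℝ) : Matrix (Fin 2) (Fin 2) ℂ :=
  !![1 - (‖r z‖ : ℂ) ^ 2,
      -(starRingEnd ℂ (r z)) * Complex.exp (-(2 * Complex.I * x * z));
     r z * Complex.exp (2 * Complex.I * x * z),
      1]

/-- `X` solves the Riemann–Hilbert problem for the Zakharov–Shabat system with reflection
coefficient `r` at the parameter `x`. Only the values of `X` off the real line matter. -/
structure IsSolution (r : ℝ → ℂ) (x : ℝ) (X : ℂ → Matrix (Fin 2) (Fin 2) ℂ) : Prop where
  /-- Every entry is analytic on `ℂ ∖ ℝ`. -/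
  analytic : ∀ j k, AnalyticOnNhd ℂ (fun z => X z j k) {z : ℂ | z.im ≠ 0}
  /-- Continuous extension from the open to the closed upper half-plane. -/
  upper_extension : ∃ E : ℂ → Matrix (Fin 2) (Fin 2) ℂ,
    ContinuousOn E {z : ℂ | 0 ≤ z.im} ∧ Set.EqOn E X {z : ℂ | 0 < z.im}
  /-- Continuous extension from the open to the closed lower half-plane. -/
  lower_extension : ∃ E : ℂ → Matrix (Fin 2) (Fin 2) ℂ,
    ContinuousOn E {z : ℂ | z.im ≤ 0} ∧ Set.EqOn E X {z : ℂ | z.im < 0}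
  /-- The limiting values `X₊`, `X₋` on the real line exist and satisfy the jump condition. -/
  jump : ∃ Xp Xm : ℝ → Matrix (Fin 2) (Fin 2) ℂ,
    (∀ z : ℝ, Tendsto (fun ε : ℝ => X ((z : ℂ) + ε * Complex.I)) (𝓝[>] 0) (𝓝 (Xp z))) ∧
    (∀ z : ℝ, Tendsto (fun ε : ℝ => X ((z : ℂ) - ε * Complex.I)) (𝓝[>] 0) (𝓝 (Xm z))) ∧
    ∀ z : ℝ, Xp z = Xm z * jumpMatrix r x z
  /-- `X(z) = I + X₁ z⁻¹ + X₂ z⁻² + O(z⁻³)` as `z → ∞` in `ℂ ∖ ℝ`, entry by entry. -/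
  normalization : ∃ X₁ X₂ : Matrix (Fin 2) (Fin 2) ℂ, ∀ j k,
    (fun z : ℂ => X z j k -
        ((1 : Matrix (Fin 2) (Fin 2) ℂ) j k + X₁ j k * z⁻¹ + X₂ j k * z⁻¹ ^ 2))
      =O[Bornology.cobounded ℂ ⊓ 𝓟 {z : ℂ | z.im ≠ 0}] (fun z : ℂ => z⁻¹ ^ 3)

end ZakharovShabat

/-!
The jump matrix factors into triangular matrices, so that with `ρ(z) = r(z) e^{2ixz}` a row `(a, b)`
of a solution satisfies `a₊ - a₋ = ρ b₊` and `b₊ - b₋ = -ρ̄ a₋`. Writing `a₋` and `b₊` as constants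
plus Fourier–Laplace integrals over a half-line turns these relations into the Marchenko equations
for the densities, whose kernel `h(t + s)` is the Fourier transform of `ρ` up to a constant:
`h(t) = √(γ/π) e^{-(t+2x)²}`. The symmetry of `h` reduces both rows to one system,
`W = h + H U`, `U = H W`, where `H` is the Hankel operator of `h` on `(0, ∞)`.

The kernel is positive with total mass `√γ ≤ 1`, and a part of this mass lies on the negative
half-line. Hence the row sums of `H` are bounded by a number less than one, even for `γ = 1`
(`setIntegral_norm_marchenkoKernel_lt_one`), `H` is a strict contraction in the supremum norm, and
a Neumann series solves the system (`exists_hankel_system`).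

The functions `U`, `W` decay like a Gaussian at `+∞`, so their transforms `u`, `w` are entire, and
so are the two matrices that make up the solution: continuity up to the line and the jump condition
are then algebra. The Marchenko equations, read on all of `ℝ`, enter through
`laplace_add_laplace_reflect`, which rewrites the entries containing `ĥ`, the transform of `h`, as
half-line transforms in the half-plane in which these converge. Integration by parts then gives the
expansion at infinity in each half-plane, with the same coefficients because `U` and `W` are smooth
across `0`.

The determinant of the solution extends to an entire function and tends to one at infinity, so it is
one. If `Y` is another solution, `Y X⁻¹` has no jump, hence is entire by Painlevé's theorem
(`differentiable_of_continuous_of_off_real`), and is the identity by Liouville's theorem.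
-/

namespace ZakharovShabat

open MeasureTheory Set

/-! ### The Hankel operator and the Marchenko system -/

/-- The Hankel integral operator on the half-line `(0, ∞)` with kernel `h (t + s)`; the result is
evaluated at every real `t`. -/
noncomputable def hankel (h G : ℝ → ℂ) (t : ℝ) : ℂ :=
  ∫ s in Ioi (0 : ℝ), h (t + s) * G s

lemma integrable_exp_neg_half_sq : Integrable fun s : ℝ => Real.exp (-s ^ 2 / 2) := by
  have := integrable_exp_neg_mul_sq (b := 1 / 2) (by norm_num)
  refine this.congr (.of_forall fun s => ?_)
  simp only
  congr 1
  ring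

lemma integrableOn_hankel_integrand {h G : ℝ → ℂ} (hc : Continuous h) {C : ℝ}
    (hC : ∀ t s, 0 ≤ t → 0 ≤ s →
      ‖h (t + s)‖ ≤ C * (Real.exp (-t ^ 2 / 2) * Real.exp (-s ^ 2 / 2)))
    (hG : ContinuousOn G (Ici 0)) {B : ℝ} (hB : ∀ s, 0 ≤ s → ‖G s‖ ≤ B) {t : ℝ} (ht : 0 ≤ t) :
    IntegrableOn (fun s => h (t + s) * G s) (Ioi 0) := by
  have hg : IntegrableOn (fun s : ℝ => C * Real.exp (-t ^ 2 / 2) * B * Real.exp (-s ^ 2 / 2))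
      (Ioi 0) := (integrable_exp_neg_half_sq.const_mul _).integrableOn
  refine Integrable.mono' hg ?_ ?_
  · refine ContinuousOn.aestronglyMeasurable ?_ measurableSet_Ioi
    exact (hc.comp (by fun_prop)).continuousOn.mul (hG.mono Ioi_subset_Ici_self)
  · refine (ae_restrict_iff' measurableSet_Ioi).2 (.of_forall fun s hs => ?_)
    have hs : 0 ≤ s := le_of_lt hs
    rw [norm_mul]
    calc _ ≤ C * (Real.exp (-t ^ 2 / 2) * Real.exp (-s ^ 2 / 2)) * B :=
          mul_le_mul (hC t s ht hs) (hB s hs) (norm_nonneg _)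
            ((norm_nonneg _).trans (hC t s ht hs))
      _ = _ := by ring

lemma norm_hankel_le_of_gaussian {h G : ℝ → ℂ} {C : ℝ}
    (hC : ∀ t s, 0 ≤ t → 0 ≤ s →
      ‖h (t + s)‖ ≤ C * (Real.exp (-t ^ 2 / 2) * Real.exp (-s ^ 2 / 2)))
    {B : ℝ} (hB : ∀ s, 0 ≤ s → ‖G s‖ ≤ B) {t : ℝ} (ht : 0 ≤ t) :
    ‖hankel h G t‖ ≤
      C * B * (∫ s in Ioi (0 : ℝ), Real.exp (-s ^ 2 / 2)) * Real.exp (-t ^ 2 / 2) := by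
  have hg : IntegrableOn (fun s : ℝ => C * Real.exp (-t ^ 2 / 2) * B * Real.exp (-s ^ 2 / 2))
      (Ioi 0) := (integrable_exp_neg_half_sq.const_mul _).integrableOn
  have := norm_integral_le_of_norm_le (f := fun s => h (t + s) * G s) hg
    ((ae_restrict_iff' measurableSet_Ioi).2 (.of_forall fun s hs => by
      have hs : 0 ≤ s := le_of_lt hs
      rw [norm_mul]
      calc _ ≤ C * (Real.exp (-t ^ 2 / 2) * Real.exp (-s ^ 2 / 2)) * B :=
            mul_le_mul (hC t s ht hs) (hB s hs) (norm_nonneg _)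
              ((norm_nonneg _).trans (hC t s ht hs))
        _ = _ := by ring))
  rw [integral_const_mul] at this
  calc _ ≤ _ := this
    _ = _ := by ring

/-- Schur's test in the supremum norm: the row sums of a Hankel kernel are largest at `t = 0`. -/
lemma norm_hankel_le {h G : ℝ → ℂ} (hi : Integrable h) {B : ℝ} (hB : ∀ s, 0 ≤ s → ‖G s‖ ≤ B)
    {t : ℝ} (ht : 0 ≤ t) :
    ‖hankel h G t‖ ≤ (∫ s in Ioi (0 : ℝ), ‖h s‖) * B := by
  have hB0 : 0 ≤ B := (norm_nonneg _).trans (hB 0 le_rfl)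
  have h1 : Integrable (fun s => ‖h (t + s)‖ * B) := (hi.comp_add_left t).norm.mul_const B
  calc ‖hankel h G t‖ ≤ ∫ s in Ioi (0 : ℝ), ‖h (t + s)‖ * B := by
        refine norm_integral_le_of_norm_le h1.integrableOn ?_
        refine (ae_restrict_iff' measurableSet_Ioi).2 (.of_forall fun s hs => ?_)
        rw [norm_mul]
        exact mul_le_mul_of_nonneg_left (hB s (le_of_lt hs)) (norm_nonneg _)
    _ = (∫ s in Ioi t, ‖h s‖) * B := by
        rw [integral_mul_const]
        congr 1
        have := (measurePreserving_add_left volume t).setIntegral_preimage_emb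
          (measurableEmbedding_addLeft t) (fun s => ‖h s‖) (Ioi t)
        rw [← this]
        simp
    _ ≤ _ := by
        refine mul_le_mul_of_nonneg_right ?_ hB0
        exact setIntegral_mono_set hi.norm.integrableOn (.of_forall fun _ => norm_nonneg _)
          (Ioi_subset_Ioi ht).eventuallyLE

/-- The Hankel operator as a bounded operator on bounded continuous functions. A function on the
half-line is stored as a function on `ℝ`, and the output is extended evenly. -/
noncomputable def hankelCLM (h : ℝ → ℂ) (hc : Continuous h) (hi : Integrable h) {C : ℝ}
    (hC : ∀ t s, 0 ≤ t → 0 ≤ s →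
      ‖h (t + s)‖ ≤ C * (Real.exp (-t ^ 2 / 2) * Real.exp (-s ^ 2 / 2))) :
    BoundedContinuousFunction ℝ ℂ →L[ℂ] BoundedContinuousFunction ℝ ℂ :=
  LinearMap.mkContinuous
    { toFun := fun f => BoundedContinuousFunction.ofNormedAddCommGroup
        (fun t => hankel h f |t|)
        (by
          have h1 : ∀ s ∈ Ioi (0:ℝ), ∀ t : ℝ, ‖h (|t| + s) * f s‖ ≤
              C * ‖f‖ * Real.exp (-s ^ 2 / 2) := by
            intro s hs t
            have hs : 0 ≤ s := le_of_lt hs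
            have h2 := hC |t| s (abs_nonneg t) hs
            have hC0 : 0 ≤ C := by simpa using (norm_nonneg _).trans (hC 0 0 le_rfl le_rfl)
            have h3 : Real.exp (-|t| ^ 2 / 2) ≤ 1 :=
              Real.exp_le_one_iff.2 (by nlinarith [sq_nonneg |t|])
            rw [norm_mul]
            calc _ ≤ C * (1 * Real.exp (-s ^ 2 / 2)) * ‖f‖ := by
                  refine mul_le_mul (h2.trans ?_) (f.norm_coe_le_norm s) (norm_nonneg _)
                    (by positivity)
                  gcongr
              _ = _ := by ring
          refine continuous_of_dominated (F := fun t s => h (|t| + s) * f s)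
            (bound := fun s => C * ‖f‖ * Real.exp (-s ^ 2 / 2)) ?_ ?_ ?_ ?_
          · exact fun t => Continuous.aestronglyMeasurable
              ((hc.comp (by fun_prop)).mul f.continuous)
          · exact fun t => (ae_restrict_iff' measurableSet_Ioi).2
              (.of_forall fun s hs => h1 s hs t)
          · exact (integrable_exp_neg_half_sq.const_mul _).integrableOn
          · exact .of_forall fun s => (hc.comp (by fun_prop)).mul continuous_const)
        ((∫ s in Ioi (0 : ℝ), ‖h s‖) * ‖f‖)
        (fun t => norm_hankel_le hi (fun s _ => f.norm_coe_le_norm s) (abs_nonneg t))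
      map_add' := fun f g => by
        ext t
        simp only [hankel, BoundedContinuousFunction.coe_ofNormedAddCommGroup,
          BoundedContinuousFunction.coe_add, Pi.add_apply, mul_add]
        exact integral_add
          (integrableOn_hankel_integrand hc hC f.continuous.continuousOn
            (fun s _ => f.norm_coe_le_norm s) (abs_nonneg t))
          (integrableOn_hankel_integrand hc hC g.continuous.continuousOn
            (fun s _ => g.norm_coe_le_norm s) (abs_nonneg t))
      map_smul' := fun c f => by
        ext t
        simp only [hankel, BoundedContinuousFunction.coe_ofNormedAddCommGroup,
          BoundedContinuousFunction.coe_smul, smul_eq_mul, RingHom.id_apply,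
          ← integral_const_mul]
        congr 1
        ext s
        ring }
    (∫ s in Ioi (0 : ℝ), ‖h s‖)
    (fun f => (BoundedContinuousFunction.norm_le (by positivity)).2 fun t =>
      norm_hankel_le hi (fun s _ => f.norm_coe_le_norm s) (abs_nonneg t))

/-- A Hankel kernel of `L¹` norm less than one on the half-line: `W = h + H U`, `U = H W` is
solved by inverting `1 - H²`. -/
lemma exists_hankel_system {h : ℝ → ℂ} (hc : Continuous h) (hi : Integrable h) {C : ℝ}
    (hC : ∀ t s, 0 ≤ t → 0 ≤ s →
      ‖h (t + s)‖ ≤ C * (Real.exp (-t ^ 2 / 2) * Real.exp (-s ^ 2 / 2)))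
    (hq : ∫ s in Ioi (0 : ℝ), ‖h s‖ < 1) :
    ∃ U W : ℝ → ℂ, (∀ t, U t = hankel h W t) ∧ (∀ t, W t = h t + hankel h U t) ∧
      ContinuousOn U (Ici 0) ∧ ContinuousOn W (Ici 0) ∧
      ∃ B : ℝ, ∀ t, 0 ≤ t →
        ‖U t‖ ≤ B * Real.exp (-t ^ 2 / 2) ∧ ‖W t‖ ≤ B * Real.exp (-t ^ 2 / 2) := by
  set A := hankelCLM h hc hi hC
  have hA1 : ‖A‖ < 1 :=
    (A.opNorm_le_bound (by positivity) fun f =>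
      (BoundedContinuousFunction.norm_le (by positivity)).2 fun t =>
        norm_hankel_le hi (fun s _ => f.norm_coe_le_norm s) (abs_nonneg t)).trans_lt hq
  have hAA : ‖A * A‖ < 1 := (norm_mul_le A A).trans_lt (by nlinarith [norm_nonneg A])
  have hA_apply : ∀ (f : BoundedContinuousFunction ℝ ℂ) (t : ℝ), A f t = hankel h f |t| :=
    fun _ _ => rfl
  have hC0 : 0 ≤ C := by simpa using (norm_nonneg _).trans (hC 0 0 le_rfl le_rfl)
  have hh : ∀ t, 0 ≤ t → ‖h t‖ ≤ C * Real.exp (-t ^ 2 / 2) := fun t ht => by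
    simpa using hC t 0 ht le_rfl
  let h₀ : BoundedContinuousFunction ℝ ℂ :=
    BoundedContinuousFunction.ofNormedAddCommGroup (fun t => h |t|)
      (hc.comp continuous_abs) C (fun t => (hh |t| (abs_nonneg t)).trans
        (mul_le_of_le_one_right hC0 (Real.exp_le_one_iff.2 (by nlinarith [sq_nonneg |t|]))))
  obtain ⟨v, hv⟩ := isUnit_one_sub_of_norm_lt_one
    (R := BoundedContinuousFunction ℝ ℂ →L[ℂ] BoundedContinuousFunction ℝ ℂ) hAA
  let W₀ : BoundedContinuousFunction ℝ ℂ := (↑v⁻¹ : _ →L[ℂ] _) h₀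
  have hW₀ : W₀ = h₀ + A (A W₀) := by
    have h1 : (1 - A * A) W₀ = h₀ := by
      have := v.mul_inv
      rw [hv] at this
      exact congrArg (fun T : BoundedContinuousFunction ℝ ℂ →L[ℂ] _ => T h₀) this
    rw [← h1]
    simp
  have hcongr : ∀ (f g : ℝ → ℂ), (∀ s, 0 ≤ s → f s = g s) → hankel h f = hankel h g := by
    intro f g hfg
    ext t
    exact setIntegral_congr_fun measurableSet_Ioi fun s hs => by
      simp only [hfg s (le_of_lt hs)]
  have hU₀ : ∀ t, 0 ≤ t → hankel h W₀ t = A W₀ t := fun t ht => by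
    rw [hA_apply, abs_of_nonneg ht]
  have hW₁ : ∀ t, 0 ≤ t → h t + hankel h (hankel h W₀) t = W₀ t := fun t ht => by
    have h1 : W₀ t = h₀ t + A (A W₀) t := congrArg (fun f => f t) hW₀
    rw [hcongr _ _ hU₀, h1, hA_apply (A W₀), abs_of_nonneg ht]
    simp [h₀, abs_of_nonneg ht]
  refine ⟨hankel h W₀, fun t => h t + hankel h (hankel h W₀) t, fun t => ?_, fun t => rfl,
    (A W₀).continuous.continuousOn.congr hU₀, W₀.continuous.continuousOn.congr hW₁,
    C + C * (‖W₀‖ + ‖A W₀‖) * (∫ s in Ioi (0 : ℝ), Real.exp (-s ^ 2 / 2)), fun t ht => ?_⟩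
  · rw [hcongr _ _ fun s hs => (hW₁ s hs)]
  · have hI : 0 ≤ ∫ s in Ioi (0 : ℝ), Real.exp (-s ^ 2 / 2) :=
      integral_nonneg fun s => (Real.exp_pos _).le
    have he := (Real.exp_pos (-t ^ 2 / 2)).le
    have e1 := norm_hankel_le_of_gaussian hC (fun s _ => W₀.norm_coe_le_norm s) ht
    have e2 := norm_hankel_le_of_gaussian hC (G := hankel h W₀)
      (fun s hs => (hU₀ s hs).symm ▸ (A W₀).norm_coe_le_norm s) ht
    have p1 : 0 ≤ C * ‖W₀‖ * (∫ s in Ioi (0 : ℝ), Real.exp (-s ^ 2 / 2)) *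
      Real.exp (-t ^ 2 / 2) := by positivity
    have p2 : 0 ≤ C * ‖A W₀‖ * (∫ s in Ioi (0 : ℝ), Real.exp (-s ^ 2 / 2)) *
      Real.exp (-t ^ 2 / 2) := by positivity
    have p3 : 0 ≤ C * Real.exp (-t ^ 2 / 2) := by positivity
    constructor
    · nlinarith
    · refine (norm_add_le _ _).trans ?_
      nlinarith [hh t ht]

/-! ### Half-line Fourier–Laplace transforms -/

/-- The Laplace transform `∫₀^∞ p(t) e^{izt} dt`, a function of `z` in the upper half-plane. -/
noncomputable def laplace (p : ℝ → ℂ) (z : ℂ) : ℂ :=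
  ∫ t in Ioi (0 : ℝ), p t * Complex.exp (Complex.I * z * t)

lemma norm_cexp_I_mul (z : ℂ) (t : ℝ) :
    ‖Complex.exp (Complex.I * z * t)‖ = Real.exp (-z.im * t) := by
  rw [Complex.norm_exp]
  simp

lemma norm_cexp_I_mul_le_one {z : ℂ} (hz : 0 < z.im) {t : ℝ} (ht : 0 ≤ t) :
    ‖Complex.exp (Complex.I * z * t)‖ ≤ 1 := by
  rw [norm_cexp_I_mul, Real.exp_le_one_iff]
  nlinarith

lemma integrableOn_laplace_integrand {p : ℝ → ℂ} (hp : IntegrableOn p (Ioi 0)) {z : ℂ}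
    (hz : 0 < z.im) :
    IntegrableOn (fun t : ℝ => p t * Complex.exp (Complex.I * z * t)) (Ioi 0) := by
  refine hp.mul_bdd (c := 1) (Continuous.aestronglyMeasurable (by fun_prop)) ?_
  exact (ae_restrict_iff' measurableSet_Ioi).2
    (.of_forall fun t ht => norm_cexp_I_mul_le_one hz (le_of_lt ht))

lemma norm_laplace_le {p : ℝ → ℂ} (hp : Integrable p) {z : ℂ} (hz : 0 < z.im) :
    ‖laplace p z‖ ≤ ∫ t, ‖p t‖ := by
  refine (norm_integral_le_of_norm_le hp.norm.integrableOn
    ((ae_restrict_iff' measurableSet_Ioi).2 (.of_forall fun t ht => ?_))).trans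
    (setIntegral_le_integral hp.norm (.of_forall fun _ => norm_nonneg _))
  rw [norm_mul]
  exact mul_le_of_le_one_right (norm_nonneg _) (norm_cexp_I_mul_le_one hz (le_of_lt ht))

/-- A sequence of functions each of which is the derivative of the one before, all integrable on
the line: a smooth function `p 0` together with its derivatives. -/
structure IsIntegrableJet (p : ℕ → ℝ → ℂ) : Prop where
  hasDerivAt : ∀ k t, HasDerivAt (p k) (p (k + 1) t) t
  integrable : ∀ k, Integrable (p k)

namespace IsIntegrableJet

variable {p q : ℕ → ℝ → ℂ}

lemma continuous (hp : IsIntegrableJet p) (k : ℕ) : Continuous (p k) :=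
  continuous_iff_continuousAt.2 fun t => (hp.hasDerivAt k t).continuousAt

lemma add (hp : IsIntegrableJet p) (hq : IsIntegrableJet q) :
    IsIntegrableJet (fun k t => p k t + q k t) where
  hasDerivAt k t := (hp.hasDerivAt k t).add (hq.hasDerivAt k t)
  integrable k := (hp.integrable k).add (hq.integrable k)

lemma reflect (hp : IsIntegrableJet p) :
    IsIntegrableJet (fun k t => (-1) ^ k * p k (-t)) where
  hasDerivAt k t := by
    have := ((hp.hasDerivAt k (-t)).scomp t (hasDerivAt_neg t)).const_mul ((-1 : ℂ) ^ k)
    refine this.congr_deriv ?_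
    simp [pow_succ]
  integrable k := (hp.integrable k).comp_neg.const_mul _

/-- Integration by parts. -/
lemma laplace_eq (hp : IsIntegrableJet p) (k : ℕ) {z : ℂ} (hz : 0 < z.im) :
    laplace (p k) z = Complex.I * z⁻¹ * (p k 0 + laplace (p (k + 1)) z) := by
  have hz0 : z ≠ 0 := by rintro rfl; simp at hz
  have i0 := integrableOn_laplace_integrand (hp.integrable k).integrableOn hz
  have i1 := integrableOn_laplace_integrand (hp.integrable (k + 1)).integrableOn hz
  have hd : ∀ t : ℝ, HasDerivAt (fun t : ℝ => p k t * Complex.exp (Complex.I * z * t))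
      (p (k + 1) t * Complex.exp (Complex.I * z * t) +
        Complex.I * z * (p k t * Complex.exp (Complex.I * z * t))) t := by
    intro t
    have h1 : HasDerivAt (fun t : ℝ => Complex.exp (Complex.I * z * t))
        (Complex.exp (Complex.I * z * t) * (Complex.I * z)) t := by
      have h2 : HasDerivAt (fun t : ℝ => Complex.I * z * (t : ℂ)) (Complex.I * z) t := by
        simpa using (Complex.ofRealCLM.hasDerivAt (x := t)).const_mul (Complex.I * z)
      exact h2.cexp
    refine ((hp.hasDerivAt k t).mul h1).congr_deriv ?_
    ring
  have i2 : IntegrableOn (fun t : ℝ => p (k + 1) t * Complex.exp (Complex.I * z * t) +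
        Complex.I * z * (p k t * Complex.exp (Complex.I * z * t))) (Ioi 0) :=
    i1.add (i0.const_mul _)
  have h := integral_Ioi_of_hasDerivAt_of_tendsto' (fun t _ => hd t) i2
    (tendsto_zero_of_hasDerivAt_of_integrableOn_Ioi (fun t _ => hd t) i2 i0)
  rw [integral_add i1 (i0.const_mul _), integral_const_mul] at h
  change laplace (p (k + 1)) z + Complex.I * z * laplace (p k) z = _ at h
  simp only [Complex.ofReal_zero, mul_zero, Complex.exp_zero, mul_one, zero_sub] at h
  have h3 : Complex.I * z * laplace (p k) z = -(p k 0 + laplace (p (k + 1)) z) := by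
    linear_combination h
  field_simp
  linear_combination (-Complex.I) * h3 + z * laplace (p k) z * Complex.I_sq

/-- The large-`z` expansion of the Laplace transform, uniform in the upper half-plane. -/
lemma exists_norm_laplace_sub_le (hp : IsIntegrableJet p) : ∃ K : ℝ, ∀ z : ℂ, 0 < z.im →
    ‖laplace (p 0) z - (Complex.I * p 0 0 * z⁻¹ - p 1 0 * z⁻¹ ^ 2)‖ ≤ K * ‖z⁻¹ ^ 3‖ := by
  refine ⟨‖p 2 0‖ + ∫ t, ‖p 3 t‖, fun z hz => ?_⟩
  have h : laplace (p 0) z - (Complex.I * p 0 0 * z⁻¹ - p 1 0 * z⁻¹ ^ 2) =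
      -Complex.I * (p 2 0 + laplace (p 3) z) * z⁻¹ ^ 3 := by
    rw [hp.laplace_eq 0 hz, hp.laplace_eq 1 hz, hp.laplace_eq 2 hz]
    linear_combination (p 1 0 * z⁻¹ ^ 2 +
      Complex.I * (p 2 0 + laplace (p 3) z) * z⁻¹ ^ 3) * Complex.I_sq
  rw [h, norm_mul, norm_mul, norm_neg, Complex.norm_I, one_mul]
  gcongr
  exact (norm_add_le _ _).trans (by gcongr; exact norm_laplace_le (hp.integrable 3) hz)

lemma exists_norm_laplace_neg_sub_le (hp : IsIntegrableJet p) : ∃ K : ℝ, ∀ z : ℂ, z.im < 0 →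
    ‖laplace (p 0) (-z) - (-Complex.I * p 0 0 * z⁻¹ - p 1 0 * z⁻¹ ^ 2)‖ ≤ K * ‖z⁻¹ ^ 3‖ := by
  obtain ⟨K, hK⟩ := hp.exists_norm_laplace_sub_le
  refine ⟨K, fun z hz => ?_⟩
  have h := hK (-z) (by simpa using hz)
  rw [inv_neg, neg_sq, norm_pow, norm_neg, ← norm_pow] at h
  rwa [neg_mul, neg_mul, ← mul_neg]

end IsIntegrableJet

section Hankel

variable {k k' G : ℝ → ℂ}

lemma integrable_prod_hankel (hc : Continuous k) (hk : Integrable k)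
    (hG : IntegrableOn G (Ioi 0)) :
    Integrable (Function.uncurry fun t s : ℝ => k (t + s) * G s)
      (volume.prod (volume.restrict (Ioi 0))) := by
  have hm : AEStronglyMeasurable (Function.uncurry fun t s : ℝ => k (t + s) * G s)
      (volume.prod (volume.restrict (Ioi 0))) :=
    (Continuous.aestronglyMeasurable (by fun_prop)).mul hG.aestronglyMeasurable.comp_snd
  refine (integrable_prod_iff' hm).2 ⟨.of_forall fun s => ?_, ?_⟩
  · simpa only [Function.uncurry] using (hk.comp_add_right s).mul_const (G s)
  · have : (fun s : ℝ => ∫ t, ‖k (t + s) * G s‖) = fun s => (∫ t, ‖k t‖) * ‖G s‖ := by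
      ext s
      simp_rw [norm_mul]
      rw [integral_mul_const, integral_add_right_eq_self (fun t => ‖k t‖)]
    simp only [Function.uncurry]
    rw [this]
    exact hG.norm.const_mul _

lemma integrable_hankel (hc : Continuous k) (hk : Integrable k) (hG : IntegrableOn G (Ioi 0)) :
    Integrable (hankel k G) :=
  (integrable_prod_hankel hc hk hG).integral_prod_left

lemma integral_hankel (hc : Continuous k) (hk : Integrable k) (hG : IntegrableOn G (Ioi 0)) :
    ∫ t, hankel k G t = (∫ t, k t) * ∫ s in Ioi (0 : ℝ), G s := by
  unfold hankel
  rw [integral_integral_swap (integrable_prod_hankel hc hk hG), ← integral_const_mul]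
  congr 1
  ext s
  rw [integral_mul_const, integral_add_right_eq_self]

lemma hasDerivAt_hankel (hd : ∀ t, HasDerivAt k (k' t) t) (hc' : Continuous k') {C C' : ℝ}
    (hC : ∀ t, ‖k t‖ ≤ C) (hC' : ∀ t, ‖k' t‖ ≤ C') (hG : IntegrableOn G (Ioi 0)) (t : ℝ) :
    HasDerivAt (hankel k G) (hankel k' G t) t := by
  have hc : Continuous k := continuous_iff_continuousAt.2 fun t => (hd t).continuousAt
  refine (hasDerivAt_integral_of_dominated_loc_of_deriv_le (F := fun t s => k (t + s) * G s)
    (F' := fun t s => k' (t + s) * G s) (bound := fun s => C' * ‖G s‖) univ_mem ?_ ?_ ?_ ?_ ?_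
    ?_).2
  · exact .of_forall fun t =>
      (Continuous.aestronglyMeasurable (by fun_prop)).mul hG.aestronglyMeasurable
  · exact hG.bdd_mul (c := C) (Continuous.aestronglyMeasurable (by fun_prop))
      (.of_forall fun s => hC _)
  · exact (Continuous.aestronglyMeasurable (by fun_prop)).mul hG.aestronglyMeasurable
  · refine .of_forall fun s t _ => ?_
    rw [norm_mul]
    exact mul_le_mul_of_nonneg_right (hC' _) (norm_nonneg _)
  · exact hG.norm.const_mul _
  · exact .of_forall fun s t _ => ((hd (t + s)).comp_add_const t s).mul_const _

lemma IsIntegrableJet.hankel {p : ℕ → ℝ → ℂ} (hp : IsIntegrableJet p)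
    (hb : ∀ k, ∃ C, ∀ t, ‖p k t‖ ≤ C) (hG : IntegrableOn G (Ioi 0)) :
    IsIntegrableJet (fun k => hankel (p k) G) where
  hasDerivAt k t := by
    obtain ⟨C, hC⟩ := hb k
    obtain ⟨C', hC'⟩ := hb (k + 1)
    exact hasDerivAt_hankel (hp.hasDerivAt k) (hp.continuous _) hC hC' hG t
  integrable k := integrable_hankel (hp.continuous k) (hp.integrable k) hG

/-- The Fourier transform diagonalizes: for `F = α h + H G` on the whole line, the two half-line
transforms of `F` add up to the Fourier transform of `h` times `α + ∫₀^∞ G(s) e^{izs} ds`. -/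
lemma laplace_add_laplace_reflect {h F G : ℝ → ℂ} {α z : ℂ} (hc : Continuous h)
    (hh : Integrable fun t : ℝ => h t * Complex.exp (-(Complex.I * z * t)))
    (hG : IntegrableOn G (Ioi 0)) (hz : 0 < z.im)
    (hF : ∀ t, F t = α * h t + hankel h G t) :
    laplace F (-z) + laplace (fun t => F (-t)) z =
      (∫ t : ℝ, h t * Complex.exp (-(Complex.I * z * t))) * (α + laplace G z) := by
  have hGz := integrableOn_laplace_integrand hG hz
  have hcz : Continuous fun t : ℝ => h t * Complex.exp (-(Complex.I * z * t)) := by fun_prop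
  have e : (fun t : ℝ => F t * Complex.exp (-(Complex.I * z * t))) =
      fun t => α * (h t * Complex.exp (-(Complex.I * z * t))) +
        hankel (fun t : ℝ => h t * Complex.exp (-(Complex.I * z * t)))
          (fun s : ℝ => G s * Complex.exp (Complex.I * z * s)) t := by
    ext t
    rw [hF, add_mul, mul_assoc]
    congr 1
    unfold hankel
    rw [← integral_mul_const]
    congr 1
    ext s
    have : Complex.exp (-(Complex.I * z * t)) =
        Complex.exp (-(Complex.I * z * ((t + s : ℝ) : ℂ))) * Complex.exp (Complex.I * z * s) := by
      rw [← Complex.exp_add]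
      congr 1
      push_cast
      ring
    rw [this]
    ring
  have hi : Integrable fun t : ℝ => F t * Complex.exp (-(Complex.I * z * t)) := by
    rw [e]
    exact (hh.const_mul α).add (integrable_hankel hcz hh hGz)
  have h1 : ∫ t : ℝ, F t * Complex.exp (-(Complex.I * z * t)) =
      (∫ t : ℝ, h t * Complex.exp (-(Complex.I * z * t))) * (α + laplace G z) := by
    rw [e, integral_add (hh.const_mul α) (integrable_hankel hcz hh hGz), integral_const_mul,
      integral_hankel hcz hh hGz]
    unfold laplace
    ring
  rw [← h1, ← intervalIntegral.integral_Iic_add_Ioi (b := 0) hi.integrableOn hi.integrableOn,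
    add_comm]
  congr 1
  · have := integral_comp_neg_Ioi (0 : ℝ) (fun t : ℝ => F t * Complex.exp (-(Complex.I * z * t)))
    rw [neg_zero] at this
    rw [← this]
    unfold laplace
    congr 1
    ext t
    simp
  · unfold laplace
    congr 1
    ext t
    congr 2
    ring

end Hankel

lemma integrable_gaussian_mul_exp (c : ℝ) :
    Integrable fun t : ℝ => Real.exp (-t ^ 2 / 2) * Real.exp (c * t) := by
  have := (integrable_cexp_quadratic (b := 1 / 2) (by norm_num) (c : ℂ) 0).norm
  refine this.congr (.of_forall fun t => ?_)
  simp only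
  rw [Complex.norm_exp, ← Real.exp_add]
  congr 1
  simp [← Complex.ofReal_pow]
  ring

/-- A Laplace transform of a function of Gaussian decay is entire. -/
lemma differentiable_laplace {p : ℝ → ℂ} (hp : ContinuousOn p (Ici 0)) {B : ℝ}
    (hB : ∀ t, 0 ≤ t → ‖p t‖ ≤ B * Real.exp (-t ^ 2 / 2)) : Differentiable ℂ (laplace p) := by
  intro z
  have hB0 : 0 ≤ B := by simpa using (norm_nonneg _).trans (hB 0 le_rfl)
  have hm : AEStronglyMeasurable p (volume.restrict (Ioi 0)) :=
    (hp.mono Ioi_subset_Ici_self).aestronglyMeasurable measurableSet_Ioi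
  refine (hasDerivAt_integral_of_dominated_loc_of_deriv_le
    (F := fun z (t : ℝ) => p t * Complex.exp (Complex.I * z * t))
    (F' := fun z (t : ℝ) => p t * (Complex.exp (Complex.I * z * t) * (Complex.I * t)))
    (bound := fun t => B * (Real.exp (-t ^ 2 / 2) * Real.exp ((‖z‖ + 2) * t)))
    (Metric.ball_mem_nhds z one_pos) ?_ ?_ ?_ ?_ ?_ ?_).2.differentiableAt
  · exact .of_forall fun w => hm.mul (Continuous.aestronglyMeasurable (by fun_prop))
  · refine Integrable.mono' ((integrable_gaussian_mul_exp ‖z‖).const_mul B).integrableOn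
      (hm.mul (Continuous.aestronglyMeasurable (by fun_prop))) ?_
    refine (ae_restrict_iff' measurableSet_Ioi).2 (.of_forall fun t ht => ?_)
    have ht : 0 ≤ t := le_of_lt ht
    rw [norm_mul, norm_cexp_I_mul, ← mul_assoc]
    refine mul_le_mul (hB t ht) (Real.exp_le_exp.2 ?_) (Real.exp_pos _).le (by positivity)
    have := (neg_le_abs z.im).trans (Complex.abs_im_le_norm z)
    nlinarith
  · exact hm.mul (Continuous.aestronglyMeasurable (by fun_prop))
  · refine (ae_restrict_iff' measurableSet_Ioi).2 (.of_forall fun t ht w hw => ?_)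
    have ht : 0 ≤ t := le_of_lt ht
    rw [norm_mul, norm_mul, norm_cexp_I_mul, ← mul_assoc B]
    refine mul_le_mul (hB t ht) ?_ (by positivity) (by positivity)
    have hw1 : ‖w‖ ≤ ‖z‖ + 1 := by
      rw [mem_ball_iff_norm] at hw
      linarith [norm_le_norm_add_norm_sub' w z]
    have h1 := (neg_le_abs w.im).trans (Complex.abs_im_le_norm w)
    have h2 : ‖Complex.I * (t : ℂ)‖ ≤ Real.exp t := by
      simp only [norm_mul, Complex.norm_I, one_mul, Complex.norm_real, Real.norm_eq_abs,
        abs_of_nonneg ht]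
      linarith [Real.add_one_le_exp t]
    calc _ ≤ Real.exp ((‖z‖ + 1) * t) * Real.exp t := by
          refine mul_le_mul (Real.exp_le_exp.2 ?_) h2 (norm_nonneg _) (Real.exp_pos _).le
          nlinarith
      _ = _ := by
          rw [← Real.exp_add]
          congr 1
          ring
  · exact ((integrable_gaussian_mul_exp (‖z‖ + 2)).const_mul B).integrableOn
  · refine .of_forall fun t w _ => ?_
    have h2 : HasDerivAt (fun w : ℂ => Complex.I * w * t) (Complex.I * t) w := by
      simpa using ((hasDerivAt_id w).const_mul Complex.I).mul_const (t : ℂ)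
    exact h2.cexp.const_mul _

/-! ### The Gaussian kernel -/

/-- The polynomials with `dᵏ/dyᵏ e^{-y²} = Pₖ(y) e^{-y²}`, that is, the Hermite polynomials up to
sign. -/
noncomputable def gaussianDerivPoly : ℕ → Polynomial ℂ
  | 0 => 1
  | k + 1 => Polynomial.derivative (gaussianDerivPoly k) -
      2 * Polynomial.X * gaussianDerivPoly k

/-- The `k`-th derivative of the Marchenko kernel `h(t) = √(γ/π) e^{-(t+2x)²}`, which is determined
by `-i h(t) = (2π)⁻¹ ∫ r(z) e^{2ixz} e^{izt} dz`. -/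
noncomputable def marchenkoKernel (x γ : ℝ) (k : ℕ) (t : ℝ) : ℂ :=
  ((Real.sqrt γ / Real.sqrt Real.pi : ℝ) : ℂ) *
    ((gaussianDerivPoly k).eval ((t + 2 * x : ℝ) : ℂ) *
      Complex.exp (-((t + 2 * x : ℝ) : ℂ) ^ 2))

lemma exists_norm_eval_le (P : Polynomial ℂ) :
    ∃ C : ℝ, 0 ≤ C ∧ ∀ y : ℝ, ‖P.eval (y : ℂ)‖ ≤ C * Real.exp |y| := by
  induction P using Polynomial.induction_on' with
  | add P Q hP hQ =>
    obtain ⟨C, hC0, hC⟩ := hP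
    obtain ⟨D, hD0, hD⟩ := hQ
    refine ⟨C + D, by positivity, fun y => ?_⟩
    rw [Polynomial.eval_add, add_mul]
    exact (norm_add_le _ _).trans (add_le_add (hC y) (hD y))
  | monomial n a =>
    refine ⟨‖a‖ * n.factorial, by positivity, fun y => ?_⟩
    rw [Polynomial.eval_monomial, norm_mul, norm_pow, Complex.norm_real, Real.norm_eq_abs,
      mul_assoc]
    gcongr
    have := Real.pow_div_factorial_le_exp |y| (abs_nonneg y) n
    rwa [div_le_iff₀' (by positivity)] at this

lemma norm_cexp_neg_sq (y : ℝ) : ‖Complex.exp (-(y : ℂ) ^ 2)‖ = Real.exp (-y ^ 2) := by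
  rw [Complex.norm_exp, ← Complex.ofReal_pow, Complex.neg_re, Complex.ofReal_re]

lemma exists_norm_eval_mul_gaussian_le (P : Polynomial ℂ) :
    ∃ C : ℝ, 0 ≤ C ∧ ∀ y : ℝ,
      ‖P.eval (y : ℂ) * Complex.exp (-(y : ℂ) ^ 2)‖ ≤ C * Real.exp (-y ^ 2 / 2) := by
  obtain ⟨C, hC0, hC⟩ := exists_norm_eval_le P
  refine ⟨C * Real.exp (1 / 2), by positivity, fun y => ?_⟩
  rw [norm_mul, norm_cexp_neg_sq]
  calc _ ≤ C * Real.exp |y| * Real.exp (-y ^ 2) :=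
        mul_le_mul_of_nonneg_right (hC y) (Real.exp_pos _).le
    _ = C * Real.exp (|y| + -y ^ 2) := by rw [mul_assoc, ← Real.exp_add]
    _ ≤ C * Real.exp (1 / 2 + -y ^ 2 / 2) := by
        refine mul_le_mul_of_nonneg_left (Real.exp_le_exp.2 ?_) hC0
        nlinarith [sq_nonneg (|y| - 1), sq_abs y]
    _ = _ := by rw [Real.exp_add, mul_assoc]

lemma hasDerivAt_eval_mul_gaussian (P : Polynomial ℂ) (y : ℂ) :
    HasDerivAt (fun y : ℂ => P.eval y * Complex.exp (-y ^ 2))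
      ((Polynomial.derivative P - 2 * Polynomial.X * P).eval y * Complex.exp (-y ^ 2)) y := by
  have h1 : HasDerivAt (fun y : ℂ => -y ^ 2) (-(2 * y)) y := by
    simpa using (hasDerivAt_pow 2 y).fun_neg
  refine ((P.hasDerivAt y).mul h1.cexp).congr_deriv ?_
  simp only [Polynomial.eval_sub, Polynomial.eval_mul, Polynomial.eval_X, Polynomial.eval_ofNat]
  ring

section Kernel

variable (x γ : ℝ)

lemma exists_norm_marchenkoKernel_le (k : ℕ) : ∃ C : ℝ, 0 ≤ C ∧ ∀ t : ℝ,
    ‖marchenkoKernel x γ k t‖ ≤ C * Real.exp (-(t + 2 * x) ^ 2 / 2) := by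
  obtain ⟨C, hC0, hC⟩ := exists_norm_eval_mul_gaussian_le (gaussianDerivPoly k)
  refine ⟨‖((Real.sqrt γ / Real.sqrt Real.pi : ℝ) : ℂ)‖ * C, by positivity, fun t => ?_⟩
  rw [marchenkoKernel, norm_mul, mul_assoc]
  gcongr
  exact hC _

lemma exists_norm_marchenkoKernel_le_const (k : ℕ) :
    ∃ C : ℝ, ∀ t : ℝ, ‖marchenkoKernel x γ k t‖ ≤ C := by
  obtain ⟨C, hC0, hC⟩ := exists_norm_marchenkoKernel_le x γ k
  refine ⟨C, fun t => (hC t).trans (mul_le_of_le_one_right hC0 (Real.exp_le_one_iff.2 ?_))⟩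
  nlinarith [sq_nonneg (t + 2 * x)]

lemma isIntegrableJet_marchenkoKernel : IsIntegrableJet (marchenkoKernel x γ) := by
  have hd : ∀ k t, HasDerivAt (marchenkoKernel x γ k) (marchenkoKernel x γ (k + 1) t) t := by
    intro k t
    have h1 := (hasDerivAt_eval_mul_gaussian (gaussianDerivPoly k)
      ((t + 2 * x : ℝ) : ℂ)).comp_ofReal
    exact (h1.comp_add_const t (2 * x)).const_mul _
  refine ⟨hd, fun k => ?_⟩
  obtain ⟨C, hC0, hC⟩ := exists_norm_marchenkoKernel_le x γ k
  refine Integrable.mono' ((integrable_exp_neg_half_sq.comp_add_right (2 * x)).const_mul C) ?_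
    (.of_forall hC)
  exact (continuous_iff_continuousAt.2 fun t => (hd k t).continuousAt).aestronglyMeasurable

lemma exists_norm_marchenkoKernel_add_le : ∃ C : ℝ, ∀ t s, 0 ≤ t → 0 ≤ s →
    ‖marchenkoKernel x γ 0 (t + s)‖ ≤
      C * (Real.exp (-t ^ 2 / 2) * Real.exp (-s ^ 2 / 2)) := by
  refine ⟨Real.sqrt γ / Real.sqrt Real.pi * Real.exp (4 * x ^ 2), fun t s ht hs => ?_⟩
  have h1 : ‖marchenkoKernel x γ 0 (t + s)‖ =
      Real.sqrt γ / Real.sqrt Real.pi * Real.exp (-(t + s + 2 * x) ^ 2) := by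
    rw [marchenkoKernel, gaussianDerivPoly, Polynomial.eval_one, one_mul, norm_mul,
      norm_cexp_neg_sq, Complex.norm_real, Real.norm_of_nonneg (by positivity)]
  rw [h1, mul_assoc, ← Real.exp_add, ← Real.exp_add]
  gcongr
  -- `(p + q)² ≥ p²/2 - q²` with `p = t + s`, `q = 2x`
  nlinarith [sq_nonneg (t + s + 4 * x), mul_nonneg ht hs]

variable {γ}

/-- The kernel has total mass `√γ ≤ 1`, and some of it lies on the negative half-line. -/
lemma setIntegral_norm_marchenkoKernel_lt_one (hγ : γ ≤ 1) :
    ∫ s in Ioi (0 : ℝ), ‖marchenkoKernel x γ 0 s‖ < 1 := by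
  have hg : Integrable fun t : ℝ => Real.exp (-(1 : ℝ) * t ^ 2) :=
    integrable_exp_neg_mul_sq one_pos
  have hg' : Integrable fun t : ℝ => Real.exp (-(1 : ℝ) * (t + 2 * x) ^ 2) :=
    hg.comp_add_right (2 * x)
  have h1 : ∀ s, ‖marchenkoKernel x γ 0 s‖ =
      Real.sqrt γ / Real.sqrt Real.pi * Real.exp (-(1 : ℝ) * (s + 2 * x) ^ 2) := by
    intro s
    rw [marchenkoKernel, gaussianDerivPoly, Polynomial.eval_one, one_mul, norm_mul,
      norm_cexp_neg_sq, Complex.norm_real, Real.norm_of_nonneg (by positivity), neg_one_mul]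
  simp_rw [h1]
  rw [integral_const_mul]
  have h2 : ∫ t : ℝ, Real.exp (-(1 : ℝ) * (t + 2 * x) ^ 2) = Real.sqrt Real.pi := by
    rw [integral_add_right_eq_self (fun t : ℝ => Real.exp (-(1 : ℝ) * t ^ 2)), integral_gaussian,
      div_one]
  have h3 := intervalIntegral.integral_Iic_add_Ioi (b := 0) hg'.integrableOn hg'.integrableOn
  have h4 : 0 < ∫ t in Iic (0 : ℝ), Real.exp (-(1 : ℝ) * (t + 2 * x) ^ 2) := by
    rw [setIntegral_pos_iff_support_of_nonneg_ae (.of_forall fun t => (Real.exp_pos _).le)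
      hg'.integrableOn]
    have : Function.support (fun t : ℝ => Real.exp (-(1 : ℝ) * (t + 2 * x) ^ 2)) = univ :=
      Function.support_eq_univ fun t => (Real.exp_pos _).ne'
    rw [this]
    simp
  have hpi : 0 < Real.sqrt Real.pi := Real.sqrt_pos.2 Real.pi_pos
  have hle : Real.sqrt γ ≤ 1 := Real.sqrt_le_one.2 hγ
  rw [div_mul_eq_mul_div, div_lt_one hpi]
  have h5 : 0 ≤ ∫ t in Ioi (0 : ℝ), Real.exp (-(1 : ℝ) * (t + 2 * x) ^ 2) :=
    integral_nonneg fun t => (Real.exp_pos _).le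
  calc _ ≤ 1 * ∫ t in Ioi (0 : ℝ), Real.exp (-(1 : ℝ) * (t + 2 * x) ^ 2) := by gcongr
    _ < _ := by linarith

variable (γ)

/-- The Fourier transform of the Marchenko kernel, an entire function; the reflection coefficient
is recovered as `r(z) e^{2ixz} = -i ĥ(z)`. -/
noncomputable def kernelTransform (z : ℂ) : ℂ :=
  (Real.sqrt γ : ℂ) * Complex.exp (-(1 / 4) * z ^ 2 + 2 * Complex.I * x * z)

lemma marchenkoKernel_mul_cexp (z : ℂ) (t : ℝ) :
    marchenkoKernel x γ 0 t * Complex.exp (-(Complex.I * z * t)) =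
      ((Real.sqrt γ / Real.sqrt Real.pi : ℝ) : ℂ) * Complex.exp (2 * Complex.I * x * z) *
        (Complex.exp (Complex.I * (-z) * ((t + 2 * x : ℝ) : ℂ)) *
          Complex.exp (-1 * ((t + 2 * x : ℝ) : ℂ) ^ 2)) := by
  rw [marchenkoKernel, gaussianDerivPoly, Polynomial.eval_one, one_mul]
  simp only [mul_assoc, ← Complex.exp_add]
  congr 2
  push_cast
  ring

lemma integrable_cexp_mul_gaussian (z : ℂ) :
    Integrable fun t : ℝ => Complex.exp (Complex.I * z * t) * Complex.exp (-1 * (t : ℂ) ^ 2) := by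
  refine (integrable_cexp_quadratic (b := 1) (by simp) (Complex.I * z) 0).congr
    (.of_forall fun t => ?_)
  simp only
  rw [← Complex.exp_add]
  congr 1
  ring

lemma integrable_marchenkoKernel_mul_cexp (z : ℂ) :
    Integrable fun t : ℝ => marchenkoKernel x γ 0 t * Complex.exp (-(Complex.I * z * t)) := by
  simp_rw [marchenkoKernel_mul_cexp]
  exact ((integrable_cexp_mul_gaussian (-z)).comp_add_right (2 * x)).const_mul _

lemma integral_marchenkoKernel_mul_cexp (z : ℂ) :
    ∫ t : ℝ, marchenkoKernel x γ 0 t * Complex.exp (-(Complex.I * z * t)) =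
      kernelTransform x γ z := by
  simp_rw [marchenkoKernel_mul_cexp]
  rw [integral_const_mul, integral_add_right_eq_self (fun t : ℝ =>
    Complex.exp (Complex.I * (-z) * (t : ℂ)) * Complex.exp (-1 * (t : ℂ) ^ 2)),
    fourierIntegral_gaussian (by simp), kernelTransform, Complex.exp_add]
  have h : ((Real.pi : ℂ) / 1) ^ (1 / 2 : ℂ) = ((Real.sqrt Real.pi : ℝ) : ℂ) := by
    rw [div_one, Real.sqrt_eq_rpow, Complex.ofReal_cpow Real.pi_pos.le]
    norm_num
  have hpi : ((Real.sqrt Real.pi : ℝ) : ℂ) ≠ 0 := by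
    exact_mod_cast (Real.sqrt_pos.2 Real.pi_pos).ne'
  rw [h]
  push_cast
  have : -(-z) ^ 2 / (4 * 1) = -(1 / 4) * z ^ 2 := by ring
  rw [this]
  field_simp

end Kernel

/-! ### Painlevé's and Liouville's theorems across the real line -/

/-- Painlevé's theorem for a line: a continuous function on the plane, holomorphic off the real
line, is entire. A rectangle that meets the line is cut along it, and each half falls under
Cauchy's theorem for functions holomorphic inside and continuous up to the boundary. -/
lemma differentiable_of_continuous_of_off_real {f : ℂ → ℂ} (hc : Continuous f)
    (hd : ∀ z : ℂ, z.im ≠ 0 → DifferentiableAt ℂ f z) : Differentiable ℂ f := by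
  have hii : ∀ a b c : ℝ, IntervalIntegrable (fun y : ℝ => f (c + y * Complex.I)) volume a b :=
    fun a b c => Continuous.intervalIntegrable (by fun_prop) _ _
  -- Cauchy's theorem for a rectangle with the real line outside its interior
  have hhalf : ∀ z w : ℂ, 0 ≤ z.im * w.im →
      (∫ x : ℝ in z.re..w.re, f (x + z.im * Complex.I)) -
      (∫ x : ℝ in z.re..w.re, f (x + w.im * Complex.I)) +
      Complex.I • (∫ y : ℝ in z.im..w.im, f (w.re + y * Complex.I)) -
      Complex.I • (∫ y : ℝ in z.im..w.im, f (z.re + y * Complex.I)) = 0 := by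
    intro z w h
    refine Complex.integral_boundary_rect_eq_zero_of_continuousOn_of_differentiableOn f z w
      hc.continuousOn fun v hv => (hd v ?_).differentiableWithinAt
    have hv2 : v.im ∈ Ioo (min z.im w.im) (max z.im w.im) := hv.2
    intro h0
    rw [h0] at hv2
    rcases le_total z.im w.im with hzw | hzw
    · rw [min_eq_left hzw, max_eq_right hzw] at hv2
      nlinarith [hv2.1, hv2.2]
    · rw [min_eq_right hzw, max_eq_left hzw] at hv2
      nlinarith [hv2.1, hv2.2]
  have hcons : Complex.IsConservativeOn f univ := by
    intro z w _
    rw [← add_eq_zero_iff_eq_neg, Complex.wedgeIntegral_add_wedgeIntegral_eq]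
    have h1 := hhalf z ⟨w.re, 0⟩ (by simp)
    have h2 := hhalf ⟨z.re, 0⟩ w (by simp)
    simp only at h1 h2
    rw [← intervalIntegral.integral_add_adjacent_intervals (hii z.im 0 w.re) (hii 0 w.im w.re),
      ← intervalIntegral.integral_add_adjacent_intervals (hii z.im 0 z.re) (hii 0 w.im z.re)]
    simp only [smul_add]
    linear_combination h1 + h2
  intro z
  exact ((hcons.mono (subset_univ (Metric.ball z 1))).isExactOn_ball hc.continuousOn
    |>.differentiableOn Metric.isOpen_ball).differentiableAt (Metric.ball_mem_nhds z one_pos)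

lemma dense_im_ne_zero : Dense {z : ℂ | z.im ≠ 0} := by
  intro z
  by_cases h : z.im = 0
  · have h1 : Tendsto (fun ε : ℝ => z + ε * Complex.I) (𝓝[>] 0) (𝓝 z) := by
      have : Continuous fun ε : ℝ => z + ε * Complex.I := by fun_prop
      simpa using (this.tendsto 0).mono_left nhdsWithin_le_nhds
    refine mem_closure_of_tendsto h1 ?_
    filter_upwards [self_mem_nhdsWithin] with ε hε
    have : 0 < ε := hε
    simp [h, this.ne']
  · exact subset_closure h

/-- Liouville's theorem across the real line. -/
lemma eq_const_of_tendsto_off_real {f : ℂ → ℂ} (hc : Continuous f)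
    (hd : ∀ z : ℂ, z.im ≠ 0 → DifferentiableAt ℂ f z) {c : ℂ}
    (hlim : Tendsto f (Bornology.cobounded ℂ ⊓ 𝓟 {z : ℂ | z.im ≠ 0}) (𝓝 c)) (z : ℂ) :
    f z = c := by
  refine (differentiable_of_continuous_of_off_real hc hd).apply_eq_of_tendsto_cocompact z ?_
  rw [← Metric.cobounded_eq_cocompact]
  refine Metric.nhds_basis_closedBall.tendsto_right_iff.2 fun ε hε => ?_
  have h1 := hlim.eventually (Metric.closedBall_mem_nhds c hε)
  rw [eventually_inf_principal] at h1
  obtain ⟨R, -, hR⟩ := (Metric.hasBasis_cobounded_compl_closedBall (0 : ℂ)).eventually_iff.1 h1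
  refine (Metric.hasBasis_cobounded_compl_closedBall (0 : ℂ)).eventually_iff.2
    ⟨R, trivial, fun z hz => ?_⟩
  have hmem : z ∈ closure ((Metric.closedBall (0 : ℂ) R)ᶜ ∩ {z : ℂ | z.im ≠ 0}) :=
    dense_im_ne_zero.open_subset_closure_inter Metric.isClosed_closedBall.isOpen_compl hz
  have := closure_minimal (s := (Metric.closedBall (0 : ℂ) R)ᶜ ∩ {z : ℂ | z.im ≠ 0})
    (t := f ⁻¹' Metric.closedBall c ε) (fun v hv => hR hv.1 hv.2)
    (Metric.isClosed_closedBall.preimage hc)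
  exact this hmem

/-! ### Uniqueness -/

open Matrix

section Uniqueness

variable {r : ℝ → ℂ} {x : ℝ} {X : ℂ → Matrix (Fin 2) (Fin 2) ℂ}

lemma IsSolution.tendsto (hX : IsSolution r x X) :
    Tendsto X (Bornology.cobounded ℂ ⊓ 𝓟 {z : ℂ | z.im ≠ 0}) (𝓝 1) := by
  obtain ⟨X₁, X₂, h⟩ := hX.normalization
  have hinv : Tendsto (fun z : ℂ => z⁻¹) (Bornology.cobounded ℂ ⊓ 𝓟 {z : ℂ | z.im ≠ 0}) (𝓝 0) :=
    tendsto_inv₀_cobounded.mono_left inf_le_left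
  refine tendsto_pi_nhds.2 fun j => tendsto_pi_nhds.2 fun k => ?_
  have h3 : Tendsto (fun z : ℂ => z⁻¹ ^ 3)
      (Bornology.cobounded ℂ ⊓ 𝓟 {z : ℂ | z.im ≠ 0}) (𝓝 0) := by
    simpa using hinv.pow 3
  have h4 := (h j k).trans_tendsto h3
  have h5 := h4.add (((hinv.const_mul (X₁ j k)).const_add ((1 : Matrix _ _ ℂ) j k)).add
    ((hinv.pow 2).const_mul (X₂ j k)))
  simpa using h5

/-- Two solutions agree as soon as one of them has determinant one and consists of two matrix
functions that are entire: the quotient has no jump, so Liouville's theorem applies. -/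
lemma IsSolution.eqOn {Y P Q : ℂ → Matrix (Fin 2) (Fin 2) ℂ} (hX : IsSolution r x X)
    (hY : IsSolution r x Y) (hP : ∀ j k, Differentiable ℂ fun z => P z j k)
    (hQ : ∀ j k, Differentiable ℂ fun z => Q z j k)
    (hXP : ∀ z : ℂ, 0 < z.im → X z = P z) (hXQ : ∀ z : ℂ, z.im < 0 → X z = Q z)
    (hPQ : ∀ z : ℝ, P z = Q z * jumpMatrix r x z)
    (hdetP : ∀ z, (P z).det = 1) (hdetQ : ∀ z, (Q z).det = 1) :
    EqOn Y X {z : ℂ | z.im ≠ 0} := by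
  obtain ⟨E, hE, hEY⟩ := hY.upper_extension
  obtain ⟨F, hF, hFY⟩ := hY.lower_extension
  obtain ⟨Yp, Ym, hYp, hYm, hjump⟩ := hY.jump
  have hPc : Continuous P := continuous_matrix fun j k => (hP j k).continuous
  have hQc : Continuous Q := continuous_matrix fun j k => (hQ j k).continuous
  have hEp : ∀ z : ℝ, E z = Yp z := by
    intro z
    have h1 : Tendsto (fun ε : ℝ => (z : ℂ) + ε * Complex.I) (𝓝[>] 0)
        (𝓝[{z : ℂ | 0 ≤ z.im}] z) := by
      refine tendsto_nhdsWithin_iff.2 ⟨?_, ?_⟩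
      · have : Continuous fun ε : ℝ => (z : ℂ) + ε * Complex.I := by fun_prop
        simpa using (this.tendsto 0).mono_left nhdsWithin_le_nhds
      · filter_upwards [self_mem_nhdsWithin] with ε hε
        simpa using le_of_lt hε
    refine tendsto_nhds_unique (((hE z (by simp)).tendsto.comp h1).congr' ?_) (hYp z)
    filter_upwards [self_mem_nhdsWithin] with ε hε
    exact hEY (by simpa using hε)
  have hFm : ∀ z : ℝ, F z = Ym z := by
    intro z
    have h1 : Tendsto (fun ε : ℝ => (z : ℂ) - ε * Complex.I) (𝓝[>] 0)
        (𝓝[{z : ℂ | z.im ≤ 0}] z) := by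
      refine tendsto_nhdsWithin_iff.2 ⟨?_, ?_⟩
      · have : Continuous fun ε : ℝ => (z : ℂ) - ε * Complex.I := by fun_prop
        simpa using (this.tendsto 0).mono_left nhdsWithin_le_nhds
      · filter_upwards [self_mem_nhdsWithin] with ε hε
        simpa using le_of_lt hε
    refine tendsto_nhds_unique (((hF z (by simp)).tendsto.comp h1).congr' ?_) (hYm z)
    filter_upwards [self_mem_nhdsWithin] with ε hε
    exact hFY (by simpa using hε)
  let M : ℂ → Matrix (Fin 2) (Fin 2) ℂ := fun z =>
    if 0 ≤ z.im then E z * (P z).adjugate else F z * (Q z).adjugate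
  have hMu : ∀ z : ℂ, 0 ≤ z.im → M z = E z * (P z).adjugate := fun z hz => if_pos hz
  have hMl : ∀ z : ℂ, z.im ≤ 0 → M z = F z * (Q z).adjugate := by
    intro z hz
    rcases hz.lt_or_eq with hz | hz
    · exact if_neg (not_le.2 hz)
    · rw [hMu z hz.ge]
      obtain ⟨t, rfl⟩ : ∃ t : ℝ, z = t := ⟨z.re, Complex.ext rfl (by simpa using hz)⟩
      have hJ : (jumpMatrix r x t).det = 1 := by
        have := congrArg Matrix.det (hPQ t)
        rwa [Matrix.det_mul, hdetP, hdetQ, one_mul, eq_comm] at this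
      rw [hEp, hFm, hjump, hPQ, Matrix.adjugate_mul_distrib, Matrix.mul_assoc,
        ← Matrix.mul_assoc (jumpMatrix r x t), Matrix.mul_adjugate, hJ, one_smul, Matrix.one_mul]
  have hMX : ∀ z : ℂ, z.im ≠ 0 → M z = Y z * (X z).adjugate := by
    intro z hz
    rcases hz.lt_or_gt with hz | hz
    · rw [hMl z hz.le, hFY hz, hXQ z hz]
    · rw [hMu z hz.le, hEY hz, hXP z hz]
  have hdetX : ∀ z : ℂ, z.im ≠ 0 → (X z).det = 1 := by
    intro z hz
    rcases hz.lt_or_gt with hz | hz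
    · rw [hXQ z hz, hdetQ]
    · rw [hXP z hz, hdetP]
  have hMc : Continuous M := by
    have hcl1 : IsClosed {z : ℂ | 0 ≤ z.im} := isClosed_le continuous_const Complex.continuous_im
    have hcl2 : IsClosed {z : ℂ | z.im ≤ 0} := isClosed_le Complex.continuous_im continuous_const
    have h1 : ContinuousOn M {z : ℂ | 0 ≤ z.im} :=
      (hE.mul hPc.matrix_adjugate.continuousOn).congr hMu
    have h2 : ContinuousOn M {z : ℂ | z.im ≤ 0} :=
      (hF.mul hQc.matrix_adjugate.continuousOn).congr hMl
    rw [← continuousOn_univ]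
    convert! h1.union_of_isClosed h2 hcl1 hcl2
    ext z
    simpa using le_total 0 z.im
  have hMlim : Tendsto M (Bornology.cobounded ℂ ⊓ 𝓟 {z : ℂ | z.im ≠ 0}) (𝓝 1) := by
    have hadj : Continuous fun A : Matrix (Fin 2) (Fin 2) ℂ => A.adjugate :=
      continuous_id.matrix_adjugate
    have h1 := hY.tendsto.mul ((hadj.tendsto 1).comp hX.tendsto)
    rw [Matrix.adjugate_one, one_mul] at h1
    refine h1.congr' ?_
    filter_upwards [mem_inf_of_right (mem_principal_self _)] with z hz
    exact (hMX z hz).symm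
  have hopen : IsOpen {z : ℂ | z.im ≠ 0} := isOpen_ne_fun Complex.continuous_im continuous_const
  have hXd : ∀ j k, ∀ z : ℂ, z.im ≠ 0 → DifferentiableAt ℂ (fun z => X z j k) z :=
    fun j k z hz => (hX.analytic j k z hz).differentiableAt
  have hYd : ∀ j k, ∀ z : ℂ, z.im ≠ 0 → DifferentiableAt ℂ (fun z => Y z j k) z :=
    fun j k z hz => (hY.analytic j k z hz).differentiableAt
  have hM1 : ∀ z, M z = 1 := by
    intro z
    ext j k
    refine eq_const_of_tendsto_off_real (f := fun z => M z j k) (hMc.matrix_elem j k)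
      (fun z hz => ?_) (tendsto_pi_nhds.1 (tendsto_pi_nhds.1 hMlim j) k) z
    have h1 : (fun z => M z j k) =ᶠ[𝓝 z] fun z => (Y z * (X z).adjugate) j k := by
      filter_upwards [hopen.mem_nhds hz] with v hv
      rw [hMX v hv]
    refine DifferentiableAt.congr_of_eventuallyEq ?_ h1
    simp only [Matrix.mul_apply, Matrix.adjugate_fin_two, Fin.sum_univ_two]
    have a := hXd 0 0 z hz
    have b := hXd 0 1 z hz
    have c := hXd 1 0 z hz
    have d := hXd 1 1 z hz
    have e := hYd j 0 z hz
    have f := hYd j 1 z hz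
    fin_cases k <;> simp <;> fun_prop
  intro z hz
  have h1 := hMX z hz
  rw [hM1] at h1
  calc Y z = Y z * ((X z).adjugate * X z) := by
        rw [Matrix.adjugate_mul, hdetX z hz, one_smul, Matrix.mul_one]
    _ = X z := by rw [← Matrix.mul_assoc, ← h1, Matrix.one_mul]

end Uniqueness

/-! ### Construction of the solution -/

section Construction

variable (u w k : ℂ → ℂ)

/-- The solution in the upper half-plane, as an entire function: `u` and `w` are the half-line
transforms of the Marchenko functions and `k` that of the kernel. -/
noncomputable def upperMatrix (z : ℂ) : Matrix (Fin 2) (Fin 2) ℂ :=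
  !![1 + u (-z) - k z * w z, -Complex.I * w z;
     Complex.I * w (-z) - Complex.I * k z * (1 + u z), 1 + u z]

/-- The solution in the lower half-plane, as an entire function. -/
noncomputable def lowerMatrix (z : ℂ) : Matrix (Fin 2) (Fin 2) ℂ :=
  !![1 + u (-z), -Complex.I * w z + Complex.I * k (-z) * (1 + u (-z));
     Complex.I * w (-z), 1 + u z - k (-z) * w (-z)]

/-- The matrix equal to `upperMatrix` above the real line and to `lowerMatrix` on and below it. -/
noncomputable def sectionalMatrix (z : ℂ) : Matrix (Fin 2) (Fin 2) ℂ :=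
  open Classical in if 0 < z.im then upperMatrix u w k z else lowerMatrix u w k z

variable {u w k}

lemma sectionalMatrix_of_pos {z : ℂ} (hz : 0 < z.im) :
    sectionalMatrix u w k z = upperMatrix u w k z := if_pos hz

lemma sectionalMatrix_of_neg {z : ℂ} (hz : z.im < 0) :
    sectionalMatrix u w k z = lowerMatrix u w k z := if_neg hz.le.not_gt

lemma differentiable_upperMatrix (hu : Differentiable ℂ u) (hw : Differentiable ℂ w)
    (hk : Differentiable ℂ k) (i j : Fin 2) :
    Differentiable ℂ fun z => upperMatrix u w k z i j := by
  fin_cases i <;> fin_cases j <;> simp [upperMatrix] <;> fun_prop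

lemma differentiable_lowerMatrix (hu : Differentiable ℂ u) (hw : Differentiable ℂ w)
    (hk : Differentiable ℂ k) (i j : Fin 2) :
    Differentiable ℂ fun z => lowerMatrix u w k z i j := by
  fin_cases i <;> fin_cases j <;> simp [lowerMatrix] <;> fun_prop

lemma det_upperMatrix (z : ℂ) :
    (upperMatrix u w k z).det = (1 + u (-z)) * (1 + u z) - w z * w (-z) := by
  rw [upperMatrix, det_fin_two_of]
  linear_combination (w z * w (-z) - w z * k z * (1 + u z)) * Complex.I_sq

lemma det_lowerMatrix (z : ℂ) :
    (lowerMatrix u w k z).det = (1 + u (-z)) * (1 + u z) - w z * w (-z) := by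
  rw [lowerMatrix, det_fin_two_of]
  linear_combination (w z * w (-z) - w (-z) * k (-z) * (1 + u (-z))) * Complex.I_sq

lemma isSolution_sectionalMatrix {r : ℝ → ℂ} {x : ℝ} (hu : Differentiable ℂ u)
    (hw : Differentiable ℂ w) (hk : Differentiable ℂ k)
    (hjump : ∀ z : ℝ, upperMatrix u w k z = lowerMatrix u w k z * jumpMatrix r x z)
    (X₁ X₂ : Matrix (Fin 2) (Fin 2) ℂ)
    (hup : ∀ i j, ∃ K : ℝ, ∀ z : ℂ, 0 < z.im → ‖upperMatrix u w k z i j -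
      ((1 : Matrix (Fin 2) (Fin 2) ℂ) i j + X₁ i j * z⁻¹ + X₂ i j * z⁻¹ ^ 2)‖ ≤ K * ‖z⁻¹ ^ 3‖)
    (hlow : ∀ i j, ∃ K : ℝ, ∀ z : ℂ, z.im < 0 → ‖lowerMatrix u w k z i j -
      ((1 : Matrix (Fin 2) (Fin 2) ℂ) i j + X₁ i j * z⁻¹ + X₂ i j * z⁻¹ ^ 2)‖ ≤ K * ‖z⁻¹ ^ 3‖) :
    IsSolution r x (sectionalMatrix u w k) := by
  have hPc : Continuous (upperMatrix u w k) :=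
    continuous_matrix fun i j => (differentiable_upperMatrix hu hw hk i j).continuous
  have hQc : Continuous (lowerMatrix u w k) :=
    continuous_matrix fun i j => (differentiable_lowerMatrix hu hw hk i j).continuous
  refine ⟨fun i j => ?_, ⟨upperMatrix u w k, hPc.continuousOn, fun z hz =>
    (sectionalMatrix_of_pos hz).symm⟩, ⟨lowerMatrix u w k, hQc.continuousOn, fun z hz =>
    (sectionalMatrix_of_neg hz).symm⟩, ⟨fun z => upperMatrix u w k z, fun z => lowerMatrix u w k z,
    fun z => ?_, fun z => ?_, hjump⟩, ⟨X₁, X₂, fun i j => ?_⟩⟩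
  · have hopen : IsOpen {z : ℂ | z.im ≠ 0} :=
      isOpen_ne_fun Complex.continuous_im continuous_const
    refine DifferentiableOn.analyticOnNhd (fun z hz => DifferentiableAt.differentiableWithinAt ?_)
      hopen
    rcases lt_or_gt_of_ne (show z.im ≠ 0 from hz) with hz | hz
    · refine (differentiable_lowerMatrix hu hw hk i j z).congr_of_eventuallyEq ?_
      filter_upwards [(isOpen_lt Complex.continuous_im continuous_const).mem_nhds hz] with v hv
      rw [sectionalMatrix_of_neg hv]
    · refine (differentiable_upperMatrix hu hw hk i j z).congr_of_eventuallyEq ?_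
      filter_upwards [(isOpen_lt continuous_const Complex.continuous_im).mem_nhds hz] with v hv
      rw [sectionalMatrix_of_pos hv]
  · have h1 : Continuous fun ε : ℝ => upperMatrix u w k (z + ε * Complex.I) :=
      hPc.comp (by fun_prop)
    have h2 := (h1.tendsto 0).mono_left (nhdsWithin_le_nhds (s := Ioi 0))
    simp only [Complex.ofReal_zero, zero_mul, add_zero] at h2
    refine h2.congr' ?_
    filter_upwards [self_mem_nhdsWithin] with ε hε
    exact (sectionalMatrix_of_pos (by simpa using hε)).symm
  · have h1 : Continuous fun ε : ℝ => lowerMatrix u w k (z - ε * Complex.I) :=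
      hQc.comp (by fun_prop)
    have h2 := (h1.tendsto 0).mono_left (nhdsWithin_le_nhds (s := Ioi 0))
    simp only [Complex.ofReal_zero, zero_mul, sub_zero] at h2
    refine h2.congr' ?_
    filter_upwards [self_mem_nhdsWithin] with ε hε
    exact (sectionalMatrix_of_neg (by simpa using hε)).symm
  · obtain ⟨K, hK⟩ := hup i j
    obtain ⟨K', hK'⟩ := hlow i j
    refine IsBigO.of_bound (max K K') ?_
    filter_upwards [mem_inf_of_right (mem_principal_self _)] with z hz
    rcases lt_or_gt_of_ne (show z.im ≠ 0 from hz) with hz | hz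
    · rw [sectionalMatrix_of_neg hz]
      exact (hK' z hz).trans (mul_le_mul_of_nonneg_right (le_max_right _ _) (norm_nonneg _))
    · rw [sectionalMatrix_of_pos hz]
      exact (hK z hz).trans (mul_le_mul_of_nonneg_right (le_max_left _ _) (norm_nonneg _))

end Construction

/-- The jump matrix in terms of `ĥ`: on the real line, complex conjugation of `ĥ` amounts to
`z ↦ -z`. -/
lemma jumpMatrix_reflection (x γ z : ℝ) :
    jumpMatrix (reflection γ) x z =
      !![1 - kernelTransform x γ z * kernelTransform x γ (-z),
          -Complex.I * kernelTransform x γ (-z);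
         -Complex.I * kernelTransform x γ z, 1] := by
  have h1 : reflection γ z * Complex.exp (2 * Complex.I * x * z) =
      -Complex.I * kernelTransform x γ z := by
    rw [reflection, kernelTransform, Complex.exp_add]
    ring
  have h2 : (starRingEnd ℂ) (reflection γ z) * Complex.exp (-(2 * Complex.I * x * z)) =
      Complex.I * kernelTransform x γ (-z) := by
    rw [reflection, kernelTransform, Complex.exp_add, map_mul, map_mul, map_neg, Complex.conj_I,
      Complex.conj_ofReal, ← Complex.exp_conj]
    have e1 : (starRingEnd ℂ) (-(1 / 4) * (z : ℂ) ^ 2) = -(1 / 4) * (-(z : ℂ)) ^ 2 := by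
      simp [map_ofNat]
    have e2 : 2 * Complex.I * (x : ℂ) * -(z : ℂ) = -(2 * Complex.I * x * z) := by ring
    rw [e1, e2]
    ring
  have h3 : ((‖reflection γ z‖ : ℝ) : ℂ) ^ 2 =
      kernelTransform x γ z * kernelTransform x γ (-z) := by
    have h4 : Complex.exp (2 * Complex.I * x * z) * Complex.exp (-(2 * Complex.I * x * z)) = 1 := by
      rw [← Complex.exp_add, add_neg_cancel, Complex.exp_zero]
    rw [← Complex.mul_conj']
    linear_combination (-(reflection γ z * (starRingEnd ℂ) (reflection γ z))) * h4 +
      (starRingEnd ℂ) (reflection γ z) * Complex.exp (-(2 * Complex.I * x * z)) * h1 -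
      Complex.I * kernelTransform x γ z * h2 -
      kernelTransform x γ z * kernelTransform x γ (-z) * Complex.I_sq
  rw [jumpMatrix, h1, h3, neg_mul, h2, ← neg_mul]

lemma upperMatrix_eq_lowerMatrix_mul (u w : ℂ → ℂ) (x γ z : ℝ) :
    upperMatrix u w (kernelTransform x γ) z =
      lowerMatrix u w (kernelTransform x γ) z * jumpMatrix (reflection γ) x z := by
  rw [jumpMatrix_reflection, upperMatrix, lowerMatrix, mul_fin_two]
  ext i j
  fin_cases i <;> fin_cases j <;> simp
  · linear_combination (kernelTransform x γ z * kernelTransform x γ (-z) * (1 + u (-z)) -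
      kernelTransform x γ z * w z) * Complex.I_sq
  · ring
  · ring
  · linear_combination w (-z) * kernelTransform x γ (-z) * Complex.I_sq

lemma differentiable_kernelTransform (x γ : ℝ) : Differentiable ℂ (kernelTransform x γ) := by
  unfold kernelTransform
  fun_prop

end ZakharovShabat

open ZakharovShabat in
theorem theorem3p8 (x γ : ℝ) (hγ : γ ∈ Set.Icc (0 : ℝ) 1) :
    ∃ X : ℂ → Matrix (Fin 2) (Fin 2) ℂ,
      ZakharovShabat.IsSolution (ZakharovShabat.reflection γ) x X ∧
      ∀ Y : ℂ → Matrix (Fin 2) (Fin 2) ℂ,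
        ZakharovShabat.IsSolution (ZakharovShabat.reflection γ) x Y →
          Set.EqOn Y X {z : ℂ | z.im ≠ 0} := by
  have hjet := isIntegrableJet_marchenkoKernel x γ
  obtain ⟨C, hC⟩ := exists_norm_marchenkoKernel_add_le x γ
  obtain ⟨U, W, hU, hW, hUc, hWc, B, hB⟩ := exists_hankel_system (hjet.continuous 0)
    (hjet.integrable 0) hC (setIntegral_norm_marchenkoKernel_lt_one x hγ.2)
  have hu : Differentiable ℂ (laplace U) := differentiable_laplace hUc fun t ht => (hB t ht).1
  have hw : Differentiable ℂ (laplace W) := differentiable_laplace hWc fun t ht => (hB t ht).2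
  have hk := differentiable_kernelTransform x γ
  have hint : ∀ p : ℝ → ℂ, ContinuousOn p (Set.Ici 0) →
      (∀ t, 0 ≤ t → ‖p t‖ ≤ B * Real.exp (-t ^ 2 / 2)) →
      MeasureTheory.IntegrableOn p (Set.Ioi 0) := fun p hp hb =>
    MeasureTheory.Integrable.mono' (integrable_exp_neg_half_sq.const_mul B).integrableOn
      ((hp.mono Set.Ioi_subset_Ici_self).aestronglyMeasurable measurableSet_Ioi)
      ((MeasureTheory.ae_restrict_iff' measurableSet_Ioi).2
        (.of_forall fun t ht => hb t (le_of_lt ht)))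
  have hUi := hint U hUc fun t ht => (hB t ht).1
  have hWi := hint W hWc fun t ht => (hB t ht).2
  have hbd := exists_norm_marchenkoKernel_le_const x γ
  -- `U` and `W` with their derivatives on the whole line
  obtain ⟨p, hp, rfl⟩ : ∃ p, IsIntegrableJet p ∧ p 0 = U :=
    ⟨_, hjet.hankel hbd hWi, (funext hU).symm⟩
  obtain ⟨q, hq, rfl⟩ : ∃ q, IsIntegrableJet q ∧ q 0 = W :=
    ⟨_, hjet.add (hjet.hankel hbd hUi), (funext hW).symm⟩
  -- the Fourier transforms of `U` and `W`, split at the origin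
  have hF1 : ∀ z : ℂ, 0 < z.im → laplace (q 0) (-z) + laplace (fun t => q 0 (-t)) z =
      kernelTransform x γ z * (1 + laplace (p 0) z) := fun z hz => by
    rw [← integral_marchenkoKernel_mul_cexp]
    exact laplace_add_laplace_reflect (hjet.continuous 0)
      (integrable_marchenkoKernel_mul_cexp x γ z) hUi hz fun t => by rw [hW, one_mul]
  have hF2 : ∀ z : ℂ, 0 < z.im → laplace (p 0) (-z) + laplace (fun t => p 0 (-t)) z =
      kernelTransform x γ z * laplace (q 0) z := fun z hz => by
    rw [← integral_marchenkoKernel_mul_cexp, ← zero_add (laplace (q 0) z)]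
    exact laplace_add_laplace_reflect (hjet.continuous 0)
      (integrable_marchenkoKernel_mul_cexp x γ z) hWi hz fun t => by rw [hU, zero_mul, zero_add]
  obtain ⟨K₁, hK₁⟩ := hp.exists_norm_laplace_sub_le
  obtain ⟨K₂, hK₂⟩ := hq.exists_norm_laplace_sub_le
  obtain ⟨K₃, hK₃⟩ := hp.reflect.exists_norm_laplace_sub_le
  obtain ⟨K₄, hK₄⟩ := hq.reflect.exists_norm_laplace_sub_le
  obtain ⟨L₁, hL₁⟩ := hp.exists_norm_laplace_neg_sub_le
  obtain ⟨L₂, hL₂⟩ := hq.exists_norm_laplace_neg_sub_le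
  obtain ⟨L₃, hL₃⟩ := hp.reflect.exists_norm_laplace_neg_sub_le
  obtain ⟨L₄, hL₄⟩ := hq.reflect.exists_norm_laplace_neg_sub_le
  simp only [pow_zero, pow_one, one_mul, neg_zero, neg_mul, sub_neg_eq_add] at hK₃ hK₄ hL₃ hL₄
  have hX : IsSolution (reflection γ) x
      (sectionalMatrix (laplace (p 0)) (laplace (q 0)) (kernelTransform x γ)) := by
    refine isSolution_sectionalMatrix hu hw hk
      (upperMatrix_eq_lowerMatrix_mul (laplace (p 0)) (laplace (q 0)) x γ)
      !![-Complex.I * p 0 0, q 0 0; q 0 0, Complex.I * p 0 0]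
      !![-p 1 0, Complex.I * q 1 0; -Complex.I * q 1 0, -p 1 0] ?_ ?_
    · intro i j
      fin_cases i <;> fin_cases j
      · refine ⟨K₃, fun z hz => (le_of_eq ?_).trans (hK₃ z hz)⟩
        rw [← norm_neg]
        congr 1
        simp [upperMatrix]
        linear_combination -hF2 z hz
      · refine ⟨K₂, fun z hz => (le_of_eq ?_).trans (hK₂ z hz)⟩
        rw [← one_mul ‖laplace (q 0) z - _‖, ← Complex.norm_I, ← norm_neg Complex.I, ← norm_mul]
        congr 1
        simp [upperMatrix]
        linear_combination -q 0 0 * z⁻¹ * Complex.I_sq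
      · refine ⟨K₄, fun z hz => (le_of_eq ?_).trans (hK₄ z hz)⟩
        rw [← one_mul ‖laplace (fun t => q 0 (-t)) z - _‖, ← Complex.norm_I,
          ← norm_neg Complex.I, ← norm_mul]
        congr 1
        simp [upperMatrix]
        linear_combination -q 0 0 * z⁻¹ * Complex.I_sq + Complex.I * hF1 z hz
      · refine ⟨K₁, fun z hz => (le_of_eq ?_).trans (hK₁ z hz)⟩
        congr 1
        simp [upperMatrix]
        ring
    · intro i j
      fin_cases i <;> fin_cases j
      · refine ⟨L₁, fun z hz => (le_of_eq ?_).trans (hL₁ z hz)⟩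
        congr 1
        simp [lowerMatrix]
        ring
      · refine ⟨L₄, fun z hz => (le_of_eq ?_).trans (hL₄ z hz)⟩
        have hF := hF1 (-z) (by simpa using hz)
        rw [neg_neg] at hF
        rw [← one_mul ‖laplace (fun t => q 0 (-t)) (-z) - _‖, ← Complex.norm_I, ← norm_mul]
        congr 1
        simp [lowerMatrix]
        linear_combination -q 0 0 * z⁻¹ * Complex.I_sq - Complex.I * hF
      · refine ⟨L₂, fun z hz => (le_of_eq ?_).trans (hL₂ z hz)⟩
        rw [← one_mul ‖laplace (q 0) (-z) - _‖, ← Complex.norm_I, ← norm_mul]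
        congr 1
        simp [lowerMatrix]
        linear_combination -q 0 0 * z⁻¹ * Complex.I_sq
      · refine ⟨L₃, fun z hz => (le_of_eq ?_).trans (hL₃ z hz)⟩
        have hF := hF2 (-z) (by simpa using hz)
        rw [neg_neg] at hF
        rw [← norm_neg]
        congr 1
        simp [lowerMatrix]
        linear_combination -hF
  -- `det X` extends to an entire function and tends to one at infinity
  have hdet : ∀ z : ℂ, (1 + laplace (p 0) (-z)) * (1 + laplace (p 0) z) -
      laplace (q 0) z * laplace (q 0) (-z) = 1 := by
    have hd : Differentiable ℂ fun z : ℂ => (1 + laplace (p 0) (-z)) * (1 + laplace (p 0) z) -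
      laplace (q 0) z * laplace (q 0) (-z) := by fun_prop
    refine eq_const_of_tendsto_off_real hd.continuous (fun z _ => hd z) ?_
    have hcont : Continuous fun A : Matrix (Fin 2) (Fin 2) ℂ => A.det :=
      continuous_id.matrix_det
    have h1 := (hcont.tendsto 1).comp hX.tendsto
    rw [Matrix.det_one] at h1
    refine h1.congr' ?_
    filter_upwards [mem_inf_of_right (mem_principal_self _)] with z hz
    rcases lt_or_gt_of_ne (show z.im ≠ 0 from hz) with hz | hz
    · rw [Function.comp_apply, sectionalMatrix_of_neg hz, det_lowerMatrix]
    · rw [Function.comp_apply, sectionalMatrix_of_pos hz, det_upperMatrix]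
  exact ⟨_, hX, fun Y hY => hX.eqOn hY (differentiable_upperMatrix hu hw hk)
    (differentiable_lowerMatrix hu hw hk) (fun z hz => sectionalMatrix_of_pos hz)
    (fun z hz => sectionalMatrix_of_neg hz) (upperMatrix_eq_lowerMatrix_mul _ _ x γ)
    (fun z => (det_upperMatrix z).trans (hdet z)) (fun z => (det_lowerMatrix z).trans (hdet z))⟩
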